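/- In the planar $k$-median problem, every user holds one point of $[0,1)^2$; for a dataset (finite multiset) $X$ of such points and a set $C \subseteq [0,1)^2$ of $k \ge 1$ centers let $\mathrm{cost}_C(X) = \sum_{x \in X} \min_{c \in C} \|c - x\|_1$. A set $C$ of $k$ centers is an $(\alpha,\kappa)$-approximation for $X$ if $\mathrm{cost}_C(X) \le \alpha \cdot \min_{C'} \mathrm{cost}_{C'}(X) + \kappa$, where $C'$ ranges over all sets of $k$ points of $[0,1)^2$. Two datasets are neighbors if one is obtained from the other by adding or removing one point, and a randomized algorithm $M$ is $\varepsilon$-DP if $\Pr[M(X) \in O] \le e^{\varepsilon} \Pr[M(X') \in O]$ for all neighbors $X, X'$ and all sets $O$ of outputs. There is a randomized algorithm $M$ that takes parameters $\lambda \in (0,1)$, $\varepsilon > 0$, $k \ge 1$ and a dataset $X \subset [0,1)^2$ of any size and outputs a set of $k$ centers in $[0,1)^2$, such that for every $\lambda \in (0,1)$ there is a constant $c_\lambda > 0$ for which the following holds for all $\varepsilon > 0$ and all $k \ge 1$: $M$ run with parameters $\lambda, \varepsilon, k$ is $\varepsilon$-DP, and for every dataset $X$ its output is, with probability at least $0.99$,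 a $\left(1+\lambda,\ c_\lambda \sqrt{k}/\varepsilon\right)$-approximation for $k$-median on $X$. -/

import Mathlib

namespace PrivateKMedian

/-- The half-open unit square `[0, 1)²`. -/
abbrev Square : Type :=
  {p : ℝ × ℝ // p.1 ∈ Set.Ico (0 : ℝ) 1 ∧ p.2 ∈ Set.Ico (0 : ℝ) 1}

/-- The `ℓ₁` distance between two points of the square. -/
noncomputable def l1Dist (p q : Square) : ℝ :=
  |p.1.1 - q.1.1| + |p.1.2 - q.1.2|

/-- A dataset: each user contributes one point of the square (with multiplicity). -/
abbrev Dataset : Type := Multiset Square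

/-- A set `C ⊆ [0, 1)²` of (exactly) `k` centers. -/
abbrev CenterSet (k : ℕ) : Type := {C : Finset Square // C.card = k}

/-- The `k`-median objective `cost_C(X) = ∑_{x ∈ X} min_{c ∈ C} ‖c - x‖₁`. For `k ≥ 1` the infimum
is over a finite non-empty set, so it is a minimum. -/
noncomputable def cost {k : ℕ} (C : CenterSet k) (X : Dataset) : ℝ :=
  (X.map fun x => ⨅ c : {c : Square // c ∈ C.1}, l1Dist c.1 x).sum

/-- `C` is an `(α, κ)`-approximation for `k`-median on `X`: its cost is at most `α` times the
smallest cost of a set of `k` centers, plus `κ`. -/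
def IsApprox {k : ℕ} (α κ : ℝ) (X : Dataset) (C : CenterSet k) : Prop :=
  ∀ C' : CenterSet k, cost C X ≤ α * cost C' X + κ

/-- Two datasets are neighbors if one results from the other by adding or removing the data of a
single user. -/
def Neighbors (X X' : Dataset) : Prop :=
  ∃ x : Square, X' = x ::ₘ X ∨ X = x ::ₘ X'

/-- The probability that a sample of `μ` lies in `O`; every set `O` is an event. -/
noncomputable def prob {Ω : Type*} (μ : PMF Ω) (O : Set Ω) : ENNReal :=
  μ.toOuterMeasure O

/-- (Pure) `ε`-differential privacy of a mechanism, given by the law `M X` of its random output on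
each dataset `X`. Laws are countably supported, so that every set of outputs is an event. -/
def IsDP {Ω : Type*} (ε : ℝ) (M : Dataset → PMF Ω) : Prop :=
  ∀ X X' : Dataset, Neighbors X X' → ∀ O : Set Ω,
    prob (M X) O ≤ ENNReal.ofReal (Real.exp ε) * prob (M X') O

end PrivateKMedian

/-!
The mechanism releases a private estimate `F` of the whole function `C ↦ cost C X` and outputs a
near-minimizer of `F`.

The estimate comes from a pruned quadtree. Let `g` be the distance to a set of centers, and let the
points of `X` move from the corner of the cell of level `i` that contains them to the corner of
their cell of level `i + 1`. This telescopes the cost into a sum over cells `v` of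
`count v * (g (corner v) - g (corner (parent v)))`, in which the coefficient of a cell of level
`i + 1` is at most `2 ^ (-i)`, so that discrete Laplace noise in the counts of small cells does
little harm. Among the children of the current cells only the `w` cells with the largest noisy
counts are kept, where `w` is of order `k / lam ^ 2`; the points in the other cells stay where they
are.

Dropping cells is harmless by comparison with a near-optimal set `C₀` of centers: on each level at
most `w` cells are near `C₀`, so the selection loses no more points than there are far from `C₀`,
up to the noise (`card_lost_le`). A point is far on level `i` only if `2 ^ (-i)` is at most a small
multiple of its distance to `C₀`, so its displacements form a geometric series that is bounded by a
small fraction of its contribution to the cost of `C₀` (`sum_outside_near_le`).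

At most `4 * min (4 ^ i) w` cells are counted when level `i` is refined, at displacement `2 ^ (-i)`.
The product peaks at the level `b` with `4 ^ b ≈ w` and decays geometrically on both sides. With a
privacy budget that decays geometrically away from `b` too, but more slowly, the budgets sum to `ε`
(`sum_budget_le`) and the expected noise to `O(√w / ε)` (`sum_noise_le`). The depth of the quadtree
is taken from a noisy estimate of the number of points, which makes the cells of the last level
negligible (`card_div_two_pow_le`).

The error is bounded in expectation, uniformly in the set of centers, by induction on the levels
(`deficit_step_le`, `expect_refine_le`). The cost of `C₀` enters this bound with a factor small
enough to survive Markov's inequality.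
-/

open scoped ENNReal

namespace PrivateKMedian

/-! ### Expectations and privacy of countably supported laws -/

section Laws

variable {α β ι : Type*}

/-- The expectation of a nonnegative function under a countably supported law. -/
noncomputable def expect (p : PMF α) (f : α → ℝ≥0∞) : ℝ≥0∞ := ∑' a, p a * f a

theorem expect_mono (p : PMF α) {f g : α → ℝ≥0∞} (h : ∀ a, f a ≤ g a) :
    expect p f ≤ expect p g :=
  ENNReal.tsum_le_tsum fun a => mul_le_mul_right (h a) _

theorem expect_const (p : PMF α) (c : ℝ≥0∞) : expect p (fun _ => c) = c := by
  rw [expect, ENNReal.tsum_mul_right, p.tsum_coe, one_mul]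

theorem expect_add (p : PMF α) (f g : α → ℝ≥0∞) :
    expect p (fun a => f a + g a) = expect p f + expect p g := by
  simp only [expect, mul_add, ENNReal.tsum_add]

theorem expect_const_mul (p : PMF α) (c : ℝ≥0∞) (f : α → ℝ≥0∞) :
    expect p (fun a => c * f a) = c * expect p f := by
  simp only [expect, ← ENNReal.tsum_mul_left]
  exact tsum_congr fun a => by ring

theorem expect_pure (a : α) (f : α → ℝ≥0∞) : expect (PMF.pure a) f = f a := by
  rw [expect, tsum_eq_single a]
  · simp
  · intro b hb
    simp [PMF.pure_apply, hb]

theorem expect_bind (p : PMF α) (q : α → PMF β) (f : β → ℝ≥0∞) :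
    expect (p.bind q) f = expect p fun a => expect (q a) f := by
  simp only [expect, PMF.bind_apply, ← ENNReal.tsum_mul_right, ← ENNReal.tsum_mul_left]
  rw [ENNReal.tsum_comm]
  exact tsum_congr fun a => tsum_congr fun b => by ring

theorem expect_map (p : PMF α) (g : α → β) (f : β → ℝ≥0∞) :
    expect (p.map g) f = expect p fun a => f (g a) := by
  rw [← PMF.bind_pure_comp, expect_bind]
  simp [expect_pure]

/-- Markov's inequality at confidence `0.99`. -/
theorem le_prob_of_expect_le (p : PMF α) {f : α → ℝ≥0∞} {A : ℝ} (hA : 0 < A)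
    (h : expect p f ≤ ENNReal.ofReal A) :
    ENNReal.ofReal (99 / 100) ≤ prob p {a | f a ≤ ENNReal.ofReal (100 * A)} := by
  set s : Set α := {a | f a ≤ ENNReal.ofReal (100 * A)} with hs
  have hsum : prob p s + prob p sᶜ = 1 := by
    rw [prob, prob, PMF.toOuterMeasure_apply, PMF.toOuterMeasure_apply, ← ENNReal.tsum_add,
      ← p.tsum_coe]
    refine tsum_congr fun a => ?_
    by_cases ha : a ∈ s <;> simp [ha]
  have hmark : prob p sᶜ * ENNReal.ofReal (100 * A) ≤ ENNReal.ofReal A := by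
    refine le_trans ?_ h
    rw [prob, PMF.toOuterMeasure_apply, ← ENNReal.tsum_mul_right]
    refine ENNReal.tsum_le_tsum fun a => ?_
    by_cases ha : a ∈ s
    · simp [ha]
    · have : ENNReal.ofReal (100 * A) ≤ f a := le_of_lt (by simpa [hs] using ha)
      simpa [ha] using mul_le_mul_right this (p a)
  have hle : prob p sᶜ ≤ ENNReal.ofReal (1 / 100) := by
    rw [← ENNReal.mul_le_mul_iff_left (c := ENNReal.ofReal (100 * A)) (by simpa using hA)
      ENNReal.ofReal_ne_top, ← ENNReal.ofReal_mul (by norm_num)]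
    convert hmark using 2
    ring
  have h1 : (1 : ℝ≥0∞) = ENNReal.ofReal (99 / 100) + ENNReal.ofReal (1 / 100) := by
    rw [← ENNReal.ofReal_add (by norm_num) (by norm_num)]
    norm_num
  have h2 : ENNReal.ofReal (99 / 100) + ENNReal.ofReal (1 / 100)
      ≤ prob p s + ENNReal.ofReal (1 / 100) := by
    rw [← h1, ← hsum]
    gcongr
  exact (ENNReal.add_le_add_iff_right ENNReal.ofReal_ne_top).1 h2

/-- The density of `p` is at most `e ^ t` times the density of `q`. For countably supported laws
this is the bound on the probabilities of events that differential privacy asks for. -/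
def LogRatioLE (t : ℝ) (p q : PMF α) : Prop :=
  ∀ a, p a ≤ ENNReal.ofReal (Real.exp t) * q a

theorem LogRatioLE.refl (p : PMF α) : LogRatioLE 0 p p := fun a => by simp

theorem LogRatioLE.mono {s t : ℝ} {p q : PMF α} (h : LogRatioLE s p q) (hst : s ≤ t) :
    LogRatioLE t p q := fun a => (h a).trans (by gcongr)

theorem LogRatioLE.bind {s t : ℝ} {p p' : PMF α} {q q' : α → PMF β} (hp : LogRatioLE s p p')
    (hq : ∀ a, LogRatioLE t (q a) (q' a)) : LogRatioLE (s + t) (p.bind q) (p'.bind q') := by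
  intro b
  rw [PMF.bind_apply, PMF.bind_apply, ← ENNReal.tsum_mul_left]
  refine ENNReal.tsum_le_tsum fun a => (mul_le_mul' (hp a) (hq a b)).trans (le_of_eq ?_)
  rw [Real.exp_add, ENNReal.ofReal_mul (Real.exp_pos s).le]
  ring

theorem LogRatioLE.map {t : ℝ} {p q : PMF α} (h : LogRatioLE t p q) (f : α → β) :
    LogRatioLE t (p.map f) (q.map f) := by
  rw [← PMF.bind_pure_comp, ← PMF.bind_pure_comp, ← add_zero t]
  exact h.bind fun a => LogRatioLE.refl _

theorem LogRatioLE.prob_le {t : ℝ} {p q : PMF α} (h : LogRatioLE t p q) (O : Set α) :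
    prob p O ≤ ENNReal.ofReal (Real.exp t) * prob q O := by
  rw [prob, prob, PMF.toOuterMeasure_apply, PMF.toOuterMeasure_apply, ← ENNReal.tsum_mul_left]
  refine ENNReal.tsum_le_tsum fun a => ?_
  by_cases ha : a ∈ O
  · simpa [ha] using h a
  · simp [ha]

/-! ### Discrete Laplace noise -/

/-- The unnormalized weight `e ^ (-a|j|)` of the discrete Laplace law. -/
noncomputable def laplaceWeight (a : ℝ) (j : ℤ) : ℝ := Real.exp (-(a * |(j : ℝ)|))

theorem laplaceWeight_nonneg (a : ℝ) (j : ℤ) : 0 ≤ laplaceWeight a j := (Real.exp_pos _).le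

theorem hasSum_laplaceWeight {a : ℝ} (ha : 0 < a) :
    HasSum (laplaceWeight a) ((1 + Real.exp (-a)) / (1 - Real.exp (-a))) := by
  have hq0 : 0 ≤ Real.exp (-a) := (Real.exp_pos _).le
  have hq1 : Real.exp (-a) < 1 := by simpa using ha
  have hg := hasSum_geometric_of_lt_one hq0 hq1
  have h := HasSum.of_nat_of_neg_add_one (f := laplaceWeight a)
    (m := (1 - Real.exp (-a))⁻¹) (m' := (1 - Real.exp (-a))⁻¹ * Real.exp (-a)) ?_ ?_
  · convert h using 1
    rw [div_eq_mul_inv]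
    ring
  · convert hg using 1
    funext n
    rw [laplaceWeight, ← Real.exp_nat_mul]
    congr 1
    simp [mul_comm]
  · have hg' : HasSum (fun n : ℕ => Real.exp (-a) ^ n * Real.exp (-a)) _ :=
      hg.mul_right (Real.exp (-a))
    convert hg' using 1
    funext n
    rw [laplaceWeight, ← Real.exp_nat_mul, ← Real.exp_add]
    congr 1
    push_cast
    rw [abs_neg, abs_of_nonneg (by positivity)]
    ring

theorem hasSum_abs_mul_laplaceWeight {a : ℝ} (ha : 0 < a) :
    HasSum (fun j : ℤ => laplaceWeight a j * |(j : ℝ)|)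
      (2 * Real.exp (-a) / (1 - Real.exp (-a)) ^ 2) := by
  have hq0 : 0 ≤ Real.exp (-a) := (Real.exp_pos _).le
  have hq1 : Real.exp (-a) < 1 := by simpa using ha
  have hg : HasSum (fun n : ℕ => (n : ℝ) * Real.exp (-a) ^ n)
      (Real.exp (-a) / (1 - Real.exp (-a)) ^ 2) :=
    hasSum_coe_mul_geometric_of_norm_lt_one (by rwa [Real.norm_of_nonneg hq0])
  have hg' : HasSum (fun n : ℕ => ((n + 1 : ℕ) : ℝ) * Real.exp (-a) ^ (n + 1))
      (Real.exp (-a) / (1 - Real.exp (-a)) ^ 2) := by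
    rw [hasSum_nat_add_iff (f := fun n : ℕ => (n : ℝ) * Real.exp (-a) ^ n)]
    simpa using hg
  have h := HasSum.of_nat_of_neg_add_one (f := fun j : ℤ => laplaceWeight a j * |(j : ℝ)|)
    (m := Real.exp (-a) / (1 - Real.exp (-a)) ^ 2)
    (m' := Real.exp (-a) / (1 - Real.exp (-a)) ^ 2) ?_ ?_
  · convert h using 1
    ring
  · convert hg using 1
    funext n
    rw [laplaceWeight, ← Real.exp_nat_mul]
    simp [mul_comm]
  · convert hg' using 1
    funext n
    rw [laplaceWeight, ← Real.exp_nat_mul]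
    push_cast
    rw [abs_neg, abs_of_nonneg (by positivity), mul_comm]
    congr 2
    ring

theorem tsum_ofReal_laplaceWeight {a : ℝ} (ha : 0 < a) :
    ∑' j, ENNReal.ofReal (laplaceWeight a j)
      = ENNReal.ofReal ((1 + Real.exp (-a)) / (1 - Real.exp (-a))) := by
  rw [← (hasSum_laplaceWeight ha).tsum_eq, ENNReal.ofReal_tsum_of_nonneg
    (laplaceWeight_nonneg a) (hasSum_laplaceWeight ha).summable]

/-- The discrete Laplace law on `ℤ`, with density proportional to `e ^ (-a|j|)`. -/
noncomputable def laplace (a : ℝ) (ha : 0 < a) : PMF ℤ :=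
  PMF.normalize (fun j => ENNReal.ofReal (laplaceWeight a j))
    (by
      refine (lt_of_lt_of_le ?_ (ENNReal.le_tsum 0)).ne'
      simp [laplaceWeight])
    (by
      rw [tsum_ofReal_laplaceWeight ha]
      exact ENNReal.ofReal_ne_top)

theorem expect_laplace_abs_le {a : ℝ} (ha : 0 < a) :
    expect (laplace a ha) (fun j => ENNReal.ofReal |(j : ℝ)|) ≤ ENNReal.ofReal (2 / a) := by
  have hq0 : 0 < Real.exp (-a) := Real.exp_pos _
  have hq1 : Real.exp (-a) < 1 := by simpa using ha
  have h1 : expect (laplace a ha) (fun j => ENNReal.ofReal |(j : ℝ)|)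
      = ENNReal.ofReal (2 * Real.exp (-a) / (1 - Real.exp (-a)) ^ 2)
        * (ENNReal.ofReal ((1 + Real.exp (-a)) / (1 - Real.exp (-a))))⁻¹ := by
    rw [← (hasSum_abs_mul_laplaceWeight ha).tsum_eq, ENNReal.ofReal_tsum_of_nonneg
      (fun j => mul_nonneg (laplaceWeight_nonneg a j) (abs_nonneg _))
      (hasSum_abs_mul_laplaceWeight ha).summable, ← ENNReal.tsum_mul_right,
      ← tsum_ofReal_laplaceWeight ha]
    refine tsum_congr fun j => ?_
    rw [laplace, PMF.normalize_apply, ENNReal.ofReal_mul (laplaceWeight_nonneg a j)]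
    ring
  have hZ : 0 < (1 + Real.exp (-a)) / (1 - Real.exp (-a)) :=
    div_pos (by linarith) (by linarith)
  rw [h1, ← ENNReal.ofReal_inv_of_pos hZ, ← ENNReal.ofReal_mul (by positivity)]
  refine ENNReal.ofReal_le_ofReal ?_
  have hne : 1 - Real.exp (-a) ≠ 0 := by linarith
  have hkey : a * Real.exp (-a) ≤ 1 - Real.exp (-a) := by
    have h := Real.add_one_le_exp a
    have h' : Real.exp a * Real.exp (-a) = 1 := by rw [← Real.exp_add]; simp
    nlinarith
  have e : 2 * Real.exp (-a) / (1 - Real.exp (-a)) ^ 2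
      * ((1 + Real.exp (-a)) / (1 - Real.exp (-a)))⁻¹
      = 2 * Real.exp (-a) / ((1 - Real.exp (-a)) * (1 + Real.exp (-a))) := by
    field_simp
  rw [e, div_le_div_iff₀ (mul_pos (by linarith) (by linarith)) ha]
  nlinarith

/-- The law of `x` plus discrete Laplace noise. For `a ≤ 0`, where there is no such noise, it is
the constant `0`. -/
noncomputable def laplaceAt (a : ℝ) (x : ℤ) : PMF ℤ :=
  if ha : 0 < a then (laplace a ha).map (x + ·) else PMF.pure 0

theorem laplaceAt_logRatioLE {a : ℝ} (ha : 0 < a) (x x' : ℤ) :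
    LogRatioLE (a * |((x - x' : ℤ) : ℝ)|) (laplaceAt a x) (laplaceAt a x') := by
  have happ : ∀ z j : ℤ, (laplace a ha).map (z + ·) j = laplace a ha (j - z) := by
    intro z j
    rw [PMF.map_apply, tsum_eq_single (j - z)]
    · simp
    · intro i hi
      rw [if_neg]
      rintro rfl
      simp at hi
  intro j
  rw [laplaceAt, laplaceAt, dif_pos ha, dif_pos ha, happ, happ, laplace, PMF.normalize_apply,
    PMF.normalize_apply, ← mul_assoc]
  gcongr
  rw [← ENNReal.ofReal_mul (Real.exp_pos _).le, laplaceWeight, laplaceWeight, ← Real.exp_add]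
  refine ENNReal.ofReal_le_ofReal (Real.exp_le_exp.2 ?_)
  have h := abs_sub_abs_le_abs_sub ((j - x' : ℤ) : ℝ) ((j - x : ℤ) : ℝ)
  have e : ((j - x' : ℤ) : ℝ) - ((j - x : ℤ) : ℝ) = ((x - x' : ℤ) : ℝ) := by push_cast; ring
  rw [e] at h
  nlinarith

theorem expect_laplaceAt_le {a : ℝ} (ha : 0 < a) (x : ℤ) :
    expect (laplaceAt a x) (fun j => ENNReal.ofReal |(j : ℝ) - x|) ≤ ENNReal.ofReal (2 / a) := by
  rw [laplaceAt, dif_pos ha, expect_map]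
  simpa using expect_laplace_abs_le ha

/-- Independent discrete Laplace noise is added to the values of `x` on a list of indices; the
other values are replaced by `0`. -/
noncomputable def noisy [DecidableEq ι] (a : ℝ) (x : ι → ℤ) : List ι → PMF (ι → ℤ)
  | [] => PMF.pure 0
  | v :: l => (laplaceAt a (x v)).bind fun j =>
      (noisy a x l).bind fun f => PMF.pure (Function.update f v j)

theorem noisy_logRatioLE [DecidableEq ι] {a : ℝ} (ha : 0 < a) (x x' : ι → ℤ) (l : List ι) :
    LogRatioLE (a * (l.map fun v => |((x v - x' v : ℤ) : ℝ)|).sum) (noisy a x l)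
      (noisy a x' l) := by
  induction l with
  | nil => simpa [noisy] using LogRatioLE.refl _
  | cons v l ih =>
    rw [List.map_cons, List.sum_cons, mul_add]
    refine (laplaceAt_logRatioLE ha _ _).bind fun j => ?_
    rw [← add_zero (a * _)]
    exact ih.bind fun f => LogRatioLE.refl _

theorem expect_noisy_le [DecidableEq ι] {a : ℝ} (ha : 0 < a) (x : ι → ℤ) (l : List ι)
    (hl : l.Nodup) :
    expect (noisy a x l) (fun y => ENNReal.ofReal (l.map fun v => |(y v : ℝ) - x v|).sum)
      ≤ ENNReal.ofReal (l.length * (2 / a)) := by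
  induction l with
  | nil => simp [noisy, expect_pure]
  | cons v l ih =>
    rw [List.nodup_cons] at hl
    have hstep : ∀ (j : ℤ) (f : ι → ℤ),
        ENNReal.ofReal ((v :: l).map fun u => |(Function.update f v j u : ℝ) - x u|).sum
          = ENNReal.ofReal |(j : ℝ) - x v|
            + ENNReal.ofReal (l.map fun u => |(f u : ℝ) - x u|).sum := by
      intro j f
      rw [← ENNReal.ofReal_add (abs_nonneg _)
        (List.sum_nonneg (by simp only [List.mem_map]; rintro _ ⟨u, -, rfl⟩; positivity)),
        List.map_cons, List.sum_cons, Function.update_self]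
      congr 3
      refine List.map_congr_left fun u hu => ?_
      rw [Function.update_of_ne (by rintro rfl; exact hl.1 hu)]
    simp only [noisy, expect_bind, expect_pure, hstep, expect_add, expect_const]
    rw [List.length_cons, Nat.cast_succ, add_one_mul, add_comm,
      ENNReal.ofReal_add (by positivity) (by positivity)]
    exact add_le_add (ih hl.2) (expect_laplaceAt_le ha _)

end Laws

/-! ### Dyadic cells of the plane -/

/-- The index of the half-open dyadic cell of side `2 ^ (-i)` that contains the point `p`. -/
noncomputable def cell (i : ℕ) (p : ℝ × ℝ) : ℤ × ℤ := (⌊2 ^ i * p.1⌋, ⌊2 ^ i * p.2⌋)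

/-- The lower left corner of the cell of level `i` with index `v`. -/
noncomputable def corner (i : ℕ) (v : ℤ × ℤ) : ℝ × ℝ := (v.1 / 2 ^ i, v.2 / 2 ^ i)

/-- The index of the cell, one level up, that contains the cell `v`. -/
def parent (v : ℤ × ℤ) : ℤ × ℤ := (v.1 / 2, v.2 / 2)

/-- The indices of the cells, one level down, that are contained in a cell of `T`. -/
def children (T : Finset (ℤ × ℤ)) : Finset (ℤ × ℤ) :=
  T.biUnion fun v => (({0, 1} : Finset ℤ) ×ˢ ({0, 1} : Finset ℤ)).image
    fun e => (2 * v.1 + e.1, 2 * v.2 + e.2)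

theorem mem_children_of_parent_mem {T : Finset (ℤ × ℤ)} {v : ℤ × ℤ} (h : parent v ∈ T) :
    v ∈ children T := by
  refine Finset.mem_biUnion.2 ⟨parent v, h, Finset.mem_image.2 ⟨(v.1 % 2, v.2 % 2), ?_, ?_⟩⟩
  · simp only [Finset.mem_product, Finset.mem_insert, Finset.mem_singleton]
    omega
  · ext <;> simp only [parent] <;> omega

theorem parent_mem_of_mem_children {T : Finset (ℤ × ℤ)} {v : ℤ × ℤ} (h : v ∈ children T) :
    parent v ∈ T := by
  simp only [children, Finset.mem_biUnion, Finset.mem_image, Finset.mem_product,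
    Finset.mem_insert, Finset.mem_singleton] at h
  obtain ⟨u, hu, e, he, rfl⟩ := h
  convert hu using 1
  ext <;> simp only [parent] <;> omega

theorem card_children_le (T : Finset (ℤ × ℤ)) : (children T).card ≤ 4 * T.card := by
  rw [mul_comm]
  refine Finset.card_biUnion_le_card_mul _ _ _ fun v _ => Finset.card_image_le.trans ?_
  simp

theorem parent_cell (i : ℕ) (p : ℝ × ℝ) : parent (cell (i + 1) p) = cell i p := by
  have h : ∀ t : ℝ, ⌊(2 : ℝ) ^ (i + 1) * t⌋ / 2 = ⌊(2 : ℝ) ^ i * t⌋ := by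
    intro t
    symm
    rw [Int.floor_eq_iff]
    have h1 := Int.floor_le ((2 : ℝ) ^ (i + 1) * t)
    have h2 := Int.lt_floor_add_one ((2 : ℝ) ^ (i + 1) * t)
    generalize ⌊(2 : ℝ) ^ (i + 1) * t⌋ = z at *
    have h3 : ((2 * (z / 2) : ℤ) : ℝ) ≤ z := by exact_mod_cast (by omega : 2 * (z / 2) ≤ z)
    have h4 : (z : ℝ) ≤ ((2 * (z / 2) + 1 : ℤ) : ℝ) := by
      exact_mod_cast (by omega : z ≤ 2 * (z / 2) + 1)
    push_cast at h3 h4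
    rw [pow_succ] at h1 h2
    constructor <;> linarith
  simp only [parent, cell, h]

theorem cell_zero (x : Square) : cell 0 x.1 = (0, 0) := by
  have h1 : ⌊x.1.1⌋ = 0 := Int.floor_eq_zero_iff.2 x.2.1
  have h2 : ⌊x.1.2⌋ = 0 := Int.floor_eq_zero_iff.2 x.2.2
  simp [cell, h1, h2]

/-! ### The distance to a set of centers -/

variable {k : ℕ}

/-- The `ℓ₁` distance from a point of the plane to the nearest center. -/
noncomputable def pointDist (C : CenterSet k) (p : ℝ × ℝ) : ℝ :=
  ⨅ c : {c : Square // c ∈ C.1}, (|c.1.1.1 - p.1| + |c.1.1.2 - p.2|)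

theorem cost_eq (C : CenterSet k) (X : Dataset) :
    cost C X = (X.map fun x => pointDist C x.1).sum := rfl

theorem pointDist_le (C : CenterSet k) (p : ℝ × ℝ) {c : Square} (hc : c ∈ C.1) :
    pointDist C p ≤ |c.1.1 - p.1| + |c.1.2 - p.2| :=
  ciInf_le (f := fun c : {c : Square // c ∈ C.1} => |c.1.1.1 - p.1| + |c.1.1.2 - p.2|)
    ⟨0, by rintro _ ⟨c, rfl⟩; positivity⟩ ⟨c, hc⟩

theorem pointDist_nonneg (C : CenterSet k) (p : ℝ × ℝ) : 0 ≤ pointDist C p :=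
  Real.iInf_nonneg fun c => by positivity

theorem cost_nonneg (C : CenterSet k) (X : Dataset) : 0 ≤ cost C X := by
  rw [cost_eq]
  refine Multiset.sum_nonneg ?_
  simp only [Multiset.mem_map]
  rintro _ ⟨x, -, rfl⟩
  exact pointDist_nonneg _ _

theorem exists_mem (hk : 1 ≤ k) (C : CenterSet k) : ∃ c, c ∈ C.1 :=
  Finset.card_pos.1 (by rw [C.2]; exact hk)

theorem le_pointDist (hk : 1 ≤ k) (C : CenterSet k) (p : ℝ × ℝ) {t : ℝ}
    (h : ∀ c ∈ C.1, t ≤ |c.1.1 - p.1| + |c.1.2 - p.2|) : t ≤ pointDist C p := by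
  obtain ⟨c, hc⟩ := exists_mem hk C
  have : Nonempty {c : Square // c ∈ C.1} := ⟨⟨c, hc⟩⟩
  exact le_ciInf fun c => h c.1 c.2

theorem pointDist_sub_le (hk : 1 ≤ k) (C : CenterSet k) (p q : ℝ × ℝ) :
    pointDist C p - pointDist C q ≤ |p.1 - q.1| + |p.2 - q.2| := by
  rw [sub_le_comm]
  refine le_pointDist hk C q fun c hc => ?_
  have h := pointDist_le C p hc
  have h1 := abs_sub_le c.1.1 q.1 p.1
  have h2 := abs_sub_le c.1.2 q.2 p.2
  rw [abs_sub_comm q.1] at h1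
  rw [abs_sub_comm q.2] at h2
  linarith

theorem abs_pointDist_sub_le (hk : 1 ≤ k) (C : CenterSet k) (p q : ℝ × ℝ) :
    |pointDist C p - pointDist C q| ≤ |p.1 - q.1| + |p.2 - q.2| := by
  rw [abs_sub_le_iff]
  refine ⟨pointDist_sub_le hk C p q, ?_⟩
  rw [abs_sub_comm p.1, abs_sub_comm p.2]
  exact pointDist_sub_le hk C q p

theorem pointDist_origin_le (hk : 1 ≤ k) (C : CenterSet k) : pointDist C (corner 0 (0, 0)) ≤ 2 := by
  obtain ⟨c, hc⟩ := exists_mem hk C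
  refine (pointDist_le C _ hc).trans ?_
  have h1 := c.2.1
  have h2 := c.2.2
  simp only [Set.mem_Ico] at h1 h2
  simp only [corner, Int.cast_zero, zero_div, sub_zero]
  rw [abs_of_nonneg h1.1, abs_of_nonneg h2.1]
  linarith

theorem abs_pointDist_sub_corner_le (hk : 1 ≤ k) (C : CenterSet k) (i : ℕ) (p : ℝ × ℝ) :
    |pointDist C p - pointDist C (corner i (cell i p))| ≤ 2 / 2 ^ i := by
  have h : ∀ t : ℝ, |t - (⌊(2 : ℝ) ^ i * t⌋ : ℝ) / 2 ^ i| ≤ 1 / 2 ^ i := by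
    intro t
    have hpos : (0 : ℝ) < 2 ^ i := by positivity
    have e : t - (⌊(2 : ℝ) ^ i * t⌋ : ℝ) / 2 ^ i
        = (2 ^ i * t - ⌊(2 : ℝ) ^ i * t⌋) / 2 ^ i := by field_simp
    have h1 := Int.floor_le ((2 : ℝ) ^ i * t)
    have h2 := Int.lt_floor_add_one ((2 : ℝ) ^ i * t)
    rw [e, abs_of_nonneg (div_nonneg (by linarith) hpos.le)]
    gcongr
    linarith
  refine (abs_pointDist_sub_le hk C _ _).trans ?_
  have h1 := h p.1
  have h2 := h p.2
  have e : (2 : ℝ) / 2 ^ i = 1 / 2 ^ i + 1 / 2 ^ i := by ring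
  rw [e]
  exact add_le_add h1 h2

theorem abs_pointDist_corner_sub_parent_le (hk : 1 ≤ k) (C : CenterSet k) (i : ℕ) (v : ℤ × ℤ) :
    |pointDist C (corner (i + 1) v) - pointDist C (corner i (parent v))| ≤ 1 / 2 ^ i := by
  have h : ∀ z : ℤ, |(z : ℝ) / 2 ^ (i + 1) - ((z / 2 : ℤ) : ℝ) / 2 ^ i| ≤ 1 / 2 ^ (i + 1) := by
    intro z
    have e : (z : ℝ) / 2 ^ (i + 1) - ((z / 2 : ℤ) : ℝ) / 2 ^ i
        = ((z - 2 * (z / 2) : ℤ) : ℝ) / 2 ^ (i + 1) := by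
      push_cast
      rw [pow_succ]
      field_simp
    have h1 : (0 : ℝ) ≤ ((z - 2 * (z / 2) : ℤ) : ℝ) := by
      exact_mod_cast (by omega : 0 ≤ z - 2 * (z / 2))
    have h2 : ((z - 2 * (z / 2) : ℤ) : ℝ) ≤ 1 := by
      exact_mod_cast (by omega : z - 2 * (z / 2) ≤ 1)
    rw [e, abs_of_nonneg (by positivity)]
    gcongr
  refine (abs_pointDist_sub_le hk C _ _).trans ?_
  have e : (1 : ℝ) / 2 ^ i = 1 / 2 ^ (i + 1) + 1 / 2 ^ (i + 1) := by
    rw [pow_succ]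
    field_simp
    norm_num
  rw [e]
  exact add_le_add (h v.1) (h v.2)

/-! ### Counts and far points -/

/-- The number of points of `X` in the cell `v` of level `i`. -/
noncomputable def count (i : ℕ) (X : Dataset) (v : ℤ × ℤ) : ℤ :=
  (X.map fun x => if cell i x.1 = v then 1 else 0).sum

theorem sum_abs_count_sub_le {X X' : Dataset} (h : Neighbors X X') (i : ℕ) {l : List (ℤ × ℤ)}
    (hl : l.Nodup) : (l.map fun v => |((count i X v - count i X' v : ℤ) : ℝ)|).sum ≤ 1 := by
  obtain ⟨x, hx⟩ := h
  have e : ∀ v, |((count i X v - count i X' v : ℤ) : ℝ)|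
      = if cell i x.1 = v then (1 : ℝ) else 0 := by
    intro v
    rcases hx with rfl | rfl <;> by_cases hv : cell i x.1 = v <;> simp [count, hv]
  simp only [e]
  rw [← List.sum_toFinset _ hl, Finset.sum_ite_eq]
  split_ifs <;> norm_num

theorem sum_count_mul (i : ℕ) (X : Dataset) (S : Finset (ℤ × ℤ)) (f : ℤ × ℤ → ℝ) :
    ∑ v ∈ S, (count i X v : ℝ) * f v
      = (X.map fun x => if cell i x.1 ∈ S then f (cell i x.1) else 0).sum := by
  induction X using Multiset.induction_on with
  | empty => simp [count]
  | cons x X ih =>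
    rw [Multiset.map_cons, Multiset.sum_cons, ← ih, ← Finset.sum_ite_eq S (cell i x.1) f,
      ← Finset.sum_add_distrib]
    refine Finset.sum_congr rfl fun v _ => ?_
    simp only [count, Multiset.map_cons, Multiset.sum_cons, Int.cast_add, add_mul]
    congr 1
    split_ifs <;> simp

/-- The number of points of `X` whose cell of level `i` is not in `N`. -/
noncomputable def outside (i : ℕ) (X : Dataset) (N : Finset (ℤ × ℤ)) : ℝ :=
  (X.map fun x => if cell i x.1 ∈ N then (0 : ℝ) else 1).sum

theorem multiset_sum_map_nonneg {X : Dataset} {f : Square → ℝ} (h : ∀ x, 0 ≤ f x) :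
    0 ≤ (X.map f).sum := by
  refine Multiset.sum_nonneg ?_
  simp only [Multiset.mem_map]
  rintro _ ⟨x, -, rfl⟩
  exact h x

theorem outside_nonneg (i : ℕ) (X : Dataset) (N : Finset (ℤ × ℤ)) : 0 ≤ outside i X N :=
  multiset_sum_map_nonneg fun x => by split_ifs <;> norm_num

/-- The cells of level `i` at most `m` cells away, in each coordinate, from the cell of a center. -/
noncomputable def near (m i : ℕ) (C : CenterSet k) : Finset (ℤ × ℤ) :=
  C.1.biUnion fun c => Finset.Icc ((cell i c.1).1 - m) ((cell i c.1).1 + m) ×ˢ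
    Finset.Icc ((cell i c.1).2 - m) ((cell i c.1).2 + m)

theorem card_near_le (m i : ℕ) (C : CenterSet k) : (near m i C).card ≤ (2 * m + 1) ^ 2 * k := by
  rw [mul_comm]
  nth_rewrite 2 [← C.2]
  refine Finset.card_biUnion_le_card_mul _ _ _ fun c _ => ?_
  rw [Finset.card_product, Int.card_Icc, Int.card_Icc, sq]
  refine Nat.mul_le_mul ?_ ?_ <;> omega

/-- A point whose cell is not near the centers is at least `m` cell sides away from them. -/
theorem le_pointDist_of_notMem_near (hk : 1 ≤ k) {m i : ℕ} {C : CenterSet k} {p : ℝ × ℝ}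
    (h : cell i p ∉ near m i C) : (m : ℝ) / 2 ^ i ≤ pointDist C p := by
  have key : ∀ s t : ℝ, ⌊(2 : ℝ) ^ i * t⌋ ∉ Finset.Icc (⌊(2 : ℝ) ^ i * s⌋ - (m : ℤ))
      (⌊(2 : ℝ) ^ i * s⌋ + m) → (m : ℝ) / 2 ^ i ≤ |s - t| := by
    intro s t hst
    rw [Finset.mem_Icc, not_and_or, not_le, not_le] at hst
    have hs1 := Int.floor_le ((2 : ℝ) ^ i * s)
    have hs2 := Int.lt_floor_add_one ((2 : ℝ) ^ i * s)
    have ht1 := Int.floor_le ((2 : ℝ) ^ i * t)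
    have ht2 := Int.lt_floor_add_one ((2 : ℝ) ^ i * t)
    rw [div_le_iff₀ (by positivity)]
    have hpos : (0 : ℝ) < 2 ^ i := by positivity
    rcases hst with hst | hst
    · have h1 : ((⌊(2 : ℝ) ^ i * t⌋ + 1 : ℤ) : ℝ) ≤ ((⌊(2 : ℝ) ^ i * s⌋ - m : ℤ) : ℝ) := by
        exact_mod_cast hst
      push_cast at h1
      nlinarith [le_abs_self (s - t)]
    · have h1 : ((⌊(2 : ℝ) ^ i * s⌋ + m + 1 : ℤ) : ℝ) ≤ ((⌊(2 : ℝ) ^ i * t⌋ : ℤ) : ℝ) := by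
        exact_mod_cast hst
      push_cast at h1
      nlinarith [neg_abs_le (s - t)]
  refine le_pointDist hk C p fun c hc => ?_
  have h' : ¬ (cell i p ∈ Finset.Icc ((cell i c.1).1 - m) ((cell i c.1).1 + m) ×ˢ
      Finset.Icc ((cell i c.1).2 - m) ((cell i c.1).2 + m)) :=
    fun hmem => h (Finset.mem_biUnion.2 ⟨c, hc, hmem⟩)
  rw [Finset.mem_product, not_and_or] at h'
  rcases h' with h' | h'
  · exact (key _ _ h').trans (le_add_of_nonneg_right (abs_nonneg _))
  · exact (key _ _ h').trans (le_add_of_nonneg_left (abs_nonneg _))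

/-- The dyadic numbers `c / 2 ^ j` that are at most `t` sum to at most `2t`. -/
theorem sum_dyadic_le (d : ℕ) {t : ℝ} (ht : 0 ≤ t) : ∀ {c : ℝ}, 0 ≤ c →
    ∑ j ∈ Finset.range d, (if c / 2 ^ j ≤ t then c / 2 ^ j else 0) ≤ 2 * t := by
  have hgeom : ∀ (n : ℕ) (c : ℝ), 0 ≤ c → ∑ j ∈ Finset.range n, c / 2 ^ j ≤ 2 * c := by
    intro n c hc
    have h := sum_geometric_two_le n
    have e : ∑ j ∈ Finset.range n, c / 2 ^ j = c * ∑ j ∈ Finset.range n, (1 / (2 : ℝ)) ^ j := by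
      rw [Finset.mul_sum]
      refine Finset.sum_congr rfl fun j _ => ?_
      rw [one_div, inv_pow, div_eq_mul_inv]
    rw [e]
    nlinarith
  induction d with
  | zero => intro c hc; simpa using ht
  | succ d ih =>
    intro c hc
    by_cases hct : c ≤ t
    · refine (Finset.sum_le_sum fun j _ => ?_).trans ((hgeom (d + 1) c hc).trans (by linarith))
      split_ifs
      · exact le_rfl
      · positivity
    · rw [Finset.sum_range_succ']
      have h := ih (c := c / 2) (by linarith)
      have e : ∀ j : ℕ, c / 2 ^ (j + 1) = c / 2 / 2 ^ j := fun j => by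
        rw [pow_succ, div_div, mul_comm]
      simp only [e]
      simpa [hct] using h

/-- Points far from the centers on the scale of their cell pay for their displacement: summed over
all levels it is a small fraction of the cost. -/
theorem sum_outside_near_le (hk : 1 ≤ k) {m : ℕ} (hm : 0 < m) (C : CenterSet k) (X : Dataset)
    (d : ℕ) :
    ∑ j ∈ Finset.range d, 2 * outside (j + 1) X (near m (j + 1) C) / 2 ^ j
      ≤ 8 / m * cost C X := by
  have hm' : (0 : ℝ) < m := by exact_mod_cast hm
  rw [cost_eq]
  induction X using Multiset.induction_on with
  | empty => simp [outside]
  | cons x X ih =>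
    rw [Multiset.map_cons, Multiset.sum_cons, mul_add]
    have e : ∀ j : ℕ, 2 * outside (j + 1) (x ::ₘ X) (near m (j + 1) C) / 2 ^ j
        = 2 * (if cell (j + 1) x.1 ∈ near m (j + 1) C then (0 : ℝ) else 1) / 2 ^ j
          + 2 * outside (j + 1) X (near m (j + 1) C) / 2 ^ j := by
      intro j
      rw [outside, outside, Multiset.map_cons, Multiset.sum_cons]
      ring
    simp only [e]
    rw [Finset.sum_add_distrib]
    refine add_le_add ?_ ih
    have h := sum_dyadic_le d (t := 4 * pointDist C x.1 / m)
      (div_nonneg (mul_nonneg (by norm_num) (pointDist_nonneg _ _)) hm'.le) (c := 2) (by norm_num)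
    have e2 : 8 / (m : ℝ) * pointDist C x.1 = 2 * (4 * pointDist C x.1 / m) := by ring
    rw [e2]
    refine (Finset.sum_le_sum fun j _ => ?_).trans h
    by_cases hmem : cell (j + 1) x.1 ∈ near m (j + 1) C
    · rw [if_pos hmem]
      split_ifs
      · rw [mul_zero, zero_div]
        positivity
      · simp
    · have hfar := le_pointDist_of_notMem_near hk hmem
      rw [if_neg hmem, if_pos]
      · simp
      · rw [le_div_iff₀ hm']
        rw [pow_succ, ← div_div] at hfar
        have : (2 : ℝ) / 2 ^ j * m = 2 * (m / 2 ^ j) := by ring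
        rw [this]
        linarith

/-! ### The private cost estimate -/

theorem exists_select (w : ℕ) (P : Finset (ℤ × ℤ)) (y : ℤ × ℤ → ℤ) :
    ∃ S ⊆ P, S.card ≤ w ∧ ∀ S' ⊆ P, S'.card ≤ w → ∑ v ∈ S', y v ≤ ∑ v ∈ S, y v := by
  obtain ⟨S, hS, hmax⟩ := (P.powerset.filter fun S => S.card ≤ w).exists_max_image
    (fun S => ∑ v ∈ S, y v) ⟨∅, by simp⟩
  simp only [Finset.mem_filter, Finset.mem_powerset] at hS hmax
  exact ⟨S, hS.1, hS.2, fun S' h1 h2 => hmax S' ⟨h1, h2⟩⟩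

/-- A set of at most `w` cells of `P` with the largest total noisy count. -/
noncomputable def select (w : ℕ) (P : Finset (ℤ × ℤ)) (y : ℤ × ℤ → ℤ) : Finset (ℤ × ℤ) :=
  (exists_select w P y).choose

theorem select_subset (w : ℕ) (P : Finset (ℤ × ℤ)) (y : ℤ × ℤ → ℤ) : select w P y ⊆ P :=
  (exists_select w P y).choose_spec.1

theorem card_select_le (w : ℕ) (P : Finset (ℤ × ℤ)) (y : ℤ × ℤ → ℤ) : (select w P y).card ≤ w :=
  (exists_select w P y).choose_spec.2.1

theorem sum_le_sum_select {w : ℕ} {P S : Finset (ℤ × ℤ)} (y : ℤ × ℤ → ℤ) (h : S ⊆ P)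
    (hS : S.card ≤ w) : ∑ v ∈ S, y v ≤ ∑ v ∈ select w P y, y v :=
  (exists_select w P y).choose_spec.2.2 S h hS

/-- The estimated change of the cost when the points in the cells `S` of level `i + 1`, counted by
`y`, move from the corners of the parent cells to the corners of their own cells. -/
noncomputable def increment (i : ℕ) (S : Finset (ℤ × ℤ)) (y : ℤ × ℤ → ℤ) (C : CenterSet k) : ℝ :=
  ∑ v ∈ S, (y v : ℝ) * (pointDist C (corner (i + 1) v) - pointDist C (corner i (parent v)))

/-- The cost estimate `F`, which resolves `X` down to the cells `T` of level `i`, is refined by `d`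
further levels: on each level the children of the current cells are counted with noise of privacy
parameter `e`, and at most `w` of them, with the largest noisy counts, are kept. -/
noncomputable def refine (w : ℕ) (e : ℕ → ℝ) (X : Dataset) :
    ℕ → ℕ → Finset (ℤ × ℤ) → (CenterSet k → ℝ) → PMF (CenterSet k → ℝ)
  | 0, _, _, F => PMF.pure F
  | d + 1, i, T, F =>
    (noisy (e (i + 1)) (count (i + 1) X) (children T).toList).bind fun y =>
      refine w e X d (i + 1) (select w (children T) y)
        fun C => F C + increment i (select w (children T) y) y C

/-- The private estimate of the function `C ↦ cost C X`: the number of points is estimated first,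
and the depth of the refinement is chosen according to it, so that the cells of the last level are
negligibly small. -/
noncomputable def costEstimate (w : ℕ) (e : ℕ → ℝ) (ε : ℝ) (X : Dataset) :
    PMF (CenterSet k → ℝ) :=
  (laplaceAt (e 0) (X.card : ℤ)).bind fun n =>
    refine w e X ⌈(n : ℝ) * ε⌉₊ 0 {(0, 0)} fun C => n * pointDist C (corner 0 (0, 0))

theorem refine_logRatioLE {e : ℕ → ℝ} (he : ∀ j, 0 < e j) (w : ℕ) {X X' : Dataset}
    (h : Neighbors X X') (d : ℕ) : ∀ (i : ℕ) (T : Finset (ℤ × ℤ)) (F : CenterSet k → ℝ),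
    LogRatioLE (∑ j ∈ Finset.range d, e (i + j + 1)) (refine w e X d i T F)
      (refine w e X' d i T F) := by
  induction d with
  | zero => intro i T F; simpa [refine] using LogRatioLE.refl _
  | succ d ih =>
    intro i T F
    rw [Finset.sum_range_succ', add_comm, add_zero]
    refine LogRatioLE.bind ((noisy_logRatioLE (he _) _ _ _).mono ?_) fun y => ?_
    · have h1 := sum_abs_count_sub_le h (i + 1) (children T).nodup_toList
      exact mul_le_of_le_one_right (he _).le h1
    · convert ih (i + 1) _ _ using 3
      congr 1
      ring

theorem costEstimate_logRatioLE {e : ℕ → ℝ} (he : ∀ j, 0 < e j) {ε : ℝ}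
    (hsum : ∀ n, ∑ j ∈ Finset.range n, e j ≤ ε) (w : ℕ) {X X' : Dataset} (h : Neighbors X X') :
    LogRatioLE ε (costEstimate (k := k) w e ε X) (costEstimate w e ε X') := by
  have hcard : |(((X.card : ℤ) - (X'.card : ℤ) : ℤ) : ℝ)| = 1 := by
    obtain ⟨x, rfl | rfl⟩ := h <;> simp
  have hroot := laplaceAt_logRatioLE (he 0) (X.card : ℤ) (X'.card : ℤ)
  rw [hcard, mul_one] at hroot
  rw [← add_sub_cancel (e 0) ε]
  refine hroot.bind fun n => (refine_logRatioLE he w h _ _ _ _).mono ?_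
  have h1 := hsum (⌈(n : ℝ) * (e 0 + (ε - e 0))⌉₊ + 1)
  rw [Finset.sum_range_succ'] at h1
  simp only [zero_add] at h1 ⊢
  linarith

/-! ### The error of the estimate -/

/-- The largest error of the cost estimate `F` over all sets of centers. -/
noncomputable def estimateError (X : Dataset) (F : CenterSet k → ℝ) : ℝ≥0∞ :=
  ⨆ C, ENNReal.ofReal |F C - cost C X|

/-- The error that `F` would have if the points in the cells `T` of level `i`, which `F` treats as
if they sat at the corners of their cells, were resolved exactly from now on. -/
noncomputable def deficit (X : Dataset) (i : ℕ) (T : Finset (ℤ × ℤ)) (F : CenterSet k → ℝ) :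
    ℝ≥0∞ :=
  ⨆ C, ENNReal.ofReal |F C + (X.map fun x => if cell i x.1 ∈ T then
    pointDist C x.1 - pointDist C (corner i (cell i x.1)) else 0).sum - cost C X|

theorem abs_multiset_sum_map_le {X : Dataset} {f g : Square → ℝ} (h : ∀ x, |f x| ≤ g x) :
    |(X.map f).sum| ≤ (X.map g).sum := by
  induction X using Multiset.induction_on with
  | empty => simp
  | cons x X ih =>
    simp only [Multiset.map_cons, Multiset.sum_cons]
    exact (abs_add_le _ _).trans (add_le_add (h x) ih)

theorem estimateError_le_deficit_add (hk : 1 ≤ k) (X : Dataset) (i : ℕ) (T : Finset (ℤ × ℤ))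
    (F : CenterSet k → ℝ) :
    estimateError X F ≤ deficit X i T F + ENNReal.ofReal (2 * X.card / 2 ^ i) := by
  refine iSup_le fun C => ?_
  refine le_trans ?_ (add_le_add_left (le_iSup _ C) _)
  rw [← ENNReal.ofReal_add (abs_nonneg _) (by positivity)]
  refine ENNReal.ofReal_le_ofReal ?_
  have h := abs_multiset_sum_map_le (X := X) (f := fun x => if cell i x.1 ∈ T then
    pointDist C x.1 - pointDist C (corner i (cell i x.1)) else 0) (g := fun _ => 2 / 2 ^ i)
    fun x => by
      split_ifs
      · exact abs_pointDist_sub_corner_le hk C i x.1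
      · rw [abs_zero]
        positivity
  rw [Multiset.map_const', Multiset.sum_replicate, nsmul_eq_mul] at h
  generalize (X.map fun x => if cell i x.1 ∈ T then
    pointDist C x.1 - pointDist C (corner i (cell i x.1)) else 0).sum = s at *
  have h2 := abs_sub (F C + s - cost C X) s
  have e1 : F C + s - cost C X - s = F C - cost C X := by ring
  have e2 : (X.card : ℝ) * (2 / 2 ^ i) = 2 * X.card / 2 ^ i := by ring
  rw [e1] at h2
  linarith

/-- The points lost by a selection number at most those outside any other admissible set `N` of
cells, up to the noise: the selected cells beat the cells of `N` by noisy count. -/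
theorem card_lost_le {w : ℕ} {P N : Finset (ℤ × ℤ)} (hN : N.card ≤ w) (i : ℕ) (X : Dataset)
    (y : ℤ × ℤ → ℤ) :
    ∑ v ∈ P, (count i X v : ℝ) - ∑ v ∈ select w P y, (count i X v : ℝ)
      ≤ outside i X N + 2 * ∑ v ∈ P, |(y v : ℝ) - count i X v| := by
  have hsel : (∑ v ∈ P ∩ N, (y v : ℝ)) ≤ ∑ v ∈ select w P y, (y v : ℝ) := by
    exact_mod_cast sum_le_sum_select y Finset.inter_subset_left
      ((Finset.card_le_card Finset.inter_subset_right).trans hN)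
  have hnoise : ∀ S ⊆ P, |∑ v ∈ S, ((y v : ℝ) - count i X v)|
      ≤ ∑ v ∈ P, |(y v : ℝ) - count i X v| := fun S hS =>
    (Finset.abs_sum_le_sum_abs _ _).trans
      (Finset.sum_le_sum_of_subset_of_nonneg hS fun _ _ _ => abs_nonneg _)
  have h1 := hnoise _ (select_subset w P y)
  have h2 := hnoise (P ∩ N) Finset.inter_subset_left
  rw [Finset.sum_sub_distrib, abs_le] at h1 h2
  have hfar : ∑ v ∈ P, (count i X v : ℝ) - ∑ v ∈ P ∩ N, (count i X v : ℝ) ≤ outside i X N := by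
    have e1 := sum_count_mul i X P fun _ => 1
    have e2 := sum_count_mul i X (P ∩ N) fun _ => 1
    simp only [mul_one] at e1 e2
    rw [e1, e2, outside, ← Multiset.sum_map_sub]
    refine Multiset.sum_map_le_sum_map _ _ fun x _ => ?_
    by_cases hP : cell i x.1 ∈ P <;> by_cases hN : cell i x.1 ∈ N <;> simp [hP, hN]
  linarith [h1.2, h2.1]

/-- One level of refinement. The deficit grows by the displacement of the points in the cells that
are dropped and by the noise in the cells that are kept. -/
theorem deficit_step_le (hk : 1 ≤ k) {w : ℕ} {N : Finset (ℤ × ℤ)} (hN : N.card ≤ w) (i : ℕ)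
    (X : Dataset) (T : Finset (ℤ × ℤ)) (F : CenterSet k → ℝ) (y : ℤ × ℤ → ℤ) :
    deficit X (i + 1) (select w (children T) y)
        (fun C => F C + increment i (select w (children T) y) y C)
      ≤ deficit X i T F + (ENNReal.ofReal (2 * outside (i + 1) X N / 2 ^ i)
        + ENNReal.ofReal (5 / 2 ^ i)
          * ENNReal.ofReal (∑ v ∈ children T, |(y v : ℝ) - count (i + 1) X v|)) := by
  set S := select w (children T) y with hS
  have hSP : S ⊆ children T := select_subset _ _ _
  have hD : 0 ≤ ∑ v ∈ children T, |(y v : ℝ) - count (i + 1) X v| :=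
    Finset.sum_nonneg fun _ _ => abs_nonneg _
  have hlost := card_lost_le (P := children T) hN (i + 1) X y
  rw [← hS] at hlost
  have hout := outside_nonneg (i + 1) X N
  refine iSup_le fun C => ?_
  refine le_trans ?_ (add_le_add_left (le_iSup _ C) _)
  rw [← ENNReal.ofReal_mul (by positivity), ← ENNReal.ofReal_add (by positivity) (by positivity),
    ← ENNReal.ofReal_add (abs_nonneg _) (by positivity)]
  refine ENNReal.ofReal_le_ofReal ?_
  set D := ∑ v ∈ children T, |(y v : ℝ) - count (i + 1) X v| with hDdef
  set coef : ℤ × ℤ → ℝ := fun v =>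
    pointDist C (corner (i + 1) v) - pointDist C (corner i (parent v)) with hcoef
  have hcoef_le : ∀ v, |coef v| ≤ 1 / 2 ^ i := abs_pointDist_corner_sub_parent_le hk C i
  -- the noise in the increment
  have hinc : |increment i S y C - ∑ v ∈ S, (count (i + 1) X v : ℝ) * coef v| ≤ D / 2 ^ i := by
    rw [increment, ← Finset.sum_sub_distrib]
    refine (Finset.abs_sum_le_sum_abs _ _).trans ?_
    rw [hDdef, Finset.sum_div]
    refine (Finset.sum_le_sum fun v _ => ?_).trans
      (Finset.sum_le_sum_of_subset_of_nonneg hSP fun _ _ _ => by positivity)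
    rw [← sub_mul, abs_mul, div_eq_mul_one_div]
    exact mul_le_mul_of_nonneg_left (hcoef_le v) (abs_nonneg _)
  -- the points in cells that are dropped stay at their corners of level `i`
  have hdrop : |(X.map fun x => if cell i x.1 ∈ T then
        pointDist C x.1 - pointDist C (corner i (cell i x.1)) else 0).sum
      - (X.map fun x => if cell (i + 1) x.1 ∈ S then
        pointDist C x.1 - pointDist C (corner (i + 1) (cell (i + 1) x.1)) else 0).sum
      - ∑ v ∈ S, (count (i + 1) X v : ℝ) * coef v|
      ≤ 2 / 2 ^ i * (∑ v ∈ children T, (count (i + 1) X v : ℝ)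
        - ∑ v ∈ S, (count (i + 1) X v : ℝ)) := by
    have e1 := sum_count_mul (i + 1) X (children T) fun _ => 1
    have e2 := sum_count_mul (i + 1) X S fun _ => 1
    simp only [mul_one] at e1 e2
    rw [e1, e2, sum_count_mul, ← Multiset.sum_map_sub, ← Multiset.sum_map_sub,
      ← Multiset.sum_map_sub, ← Multiset.sum_map_mul_left]
    refine abs_multiset_sum_map_le fun x => ?_
    have hpar := parent_cell i x.1
    have hb := abs_pointDist_sub_corner_le hk C i x.1
    by_cases hxS : cell (i + 1) x.1 ∈ S
    · have hxT : cell i x.1 ∈ T := hpar ▸ parent_mem_of_mem_children (hSP hxS)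
      simp [hxS, hxT, hSP hxS, hcoef, hpar]
    · by_cases hxT : cell i x.1 ∈ T
      · have hxP : cell (i + 1) x.1 ∈ children T := mem_children_of_parent_mem (by rwa [hpar])
        simpa [hxS, hxT, hxP] using hb
      · have hxP : cell (i + 1) x.1 ∉ children T := fun hc =>
          hxT (hpar ▸ parent_mem_of_mem_children hc)
        simp [hxS, hxT, hxP]
  generalize (X.map fun x => if cell i x.1 ∈ T then
    pointDist C x.1 - pointDist C (corner i (cell i x.1)) else 0).sum = s at *
  generalize (X.map fun x => if cell (i + 1) x.1 ∈ S then
    pointDist C x.1 - pointDist C (corner (i + 1) (cell (i + 1) x.1)) else 0).sum = s' at *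
  generalize ∑ v ∈ S, (count (i + 1) X v : ℝ) * coef v = q at *
  have hdrop' := hdrop.trans (mul_le_mul_of_nonneg_left hlost (by positivity))
  have e3 : F C + increment i S y C + s' - cost C X
      = (F C + s - cost C X) + ((increment i S y C - q) - (s - s' - q)) := by ring
  have e4 : 2 * outside (i + 1) X N / 2 ^ i + 5 / 2 ^ i * D
      = D / 2 ^ i + 2 / 2 ^ i * (outside (i + 1) X N + 2 * D) := by ring
  rw [e3, e4]
  refine (abs_add_le _ _).trans (add_le_add le_rfl ((abs_sub _ _).trans ?_))
  exact add_le_add hinc hdrop'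

/-- The expected error of the refinement: the initial deficit, the loss on every level, and the
size of the cells of the last level. There are at most `4 * min (4 ^ j) w` children to be counted
when level `j` is refined. -/
theorem expect_refine_le (hk : 1 ≤ k) {w : ℕ} {e : ℕ → ℝ} (he : ∀ j, 0 < e j) (X : Dataset)
    {N : ℕ → Finset (ℤ × ℤ)} (hN : ∀ j, (N j).card ≤ w) (d : ℕ) :
    ∀ (i : ℕ) (T : Finset (ℤ × ℤ)) (F : CenterSet k → ℝ), T.card ≤ min (4 ^ i) w →
      expect (refine w e X d i T F) (estimateError X)
        ≤ deficit X i T F + ENNReal.ofReal (∑ j ∈ Finset.range d,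
            (2 * outside (i + j + 1) X (N (i + j + 1)) / 2 ^ (i + j)
              + 40 * (min (4 ^ (i + j)) w : ℕ) / 2 ^ (i + j) / e (i + j + 1)))
          + ENNReal.ofReal (2 * X.card / 2 ^ (i + d)) := by
  induction d with
  | zero =>
    intro i T F _
    simpa [refine, expect_pure] using estimateError_le_deficit_add hk X i T F
  | succ d ih =>
    intro i T F hT
    set τ : ℕ → ℝ := fun j => 2 * outside (j + 1) X (N (j + 1)) / 2 ^ j
      + 40 * (min (4 ^ j) w : ℕ) / 2 ^ j / e (j + 1) with hτ
    have hτ0 : ∀ j, 0 ≤ τ j := fun j => by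
      have h1 := outside_nonneg (j + 1) X (N (j + 1))
      have h2 := he (j + 1)
      positivity
    have hcard : ∀ y, (select w (children T) y).card ≤ min (4 ^ (i + 1)) w := by
      intro y
      refine le_min ?_ (card_select_le _ _ _)
      refine (Finset.card_le_card (select_subset _ _ _)).trans ((card_children_le T).trans ?_)
      rw [pow_succ, mul_comm]
      exact Nat.mul_le_mul_right 4 (hT.trans (min_le_left _ _))
    rw [refine, expect_bind]
    set tail : ℝ≥0∞ := ENNReal.ofReal (∑ j ∈ Finset.range d, τ (i + 1 + j))
      + ENNReal.ofReal (2 * X.card / 2 ^ (i + 1 + d)) with htail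
    have hstep : ∀ y, expect (refine w e X d (i + 1) (select w (children T) y)
          fun C => F C + increment i (select w (children T) y) y C) (estimateError X)
        ≤ (deficit X i T F + ENNReal.ofReal (2 * outside (i + 1) X (N (i + 1)) / 2 ^ i) + tail)
          + ENNReal.ofReal (5 / 2 ^ i) * ENNReal.ofReal
            ((children T).toList.map fun v => |(y v : ℝ) - count (i + 1) X v|).sum := by
      intro y
      refine (ih (i + 1) _ _ (hcard y)).trans ?_
      rw [add_assoc]
      refine (add_le_add_left (deficit_step_le hk (hN (i + 1)) i X T F y) _).trans
        (le_of_eq ?_)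
      rw [Finset.sum_map_toList]
      ring
    refine (expect_mono _ hstep).trans ?_
    rw [expect_add, expect_const, expect_const_mul]
    have hnoise := expect_noisy_le (he (i + 1)) (count (i + 1) X) _ (children T).nodup_toList
    rw [Finset.length_toList] at hnoise
    have hnoise' : ENNReal.ofReal (5 / 2 ^ i)
          * expect (noisy (e (i + 1)) (count (i + 1) X) (children T).toList)
            (fun y => ENNReal.ofReal
              ((children T).toList.map fun v => |(y v : ℝ) - count (i + 1) X v|).sum)
        ≤ ENNReal.ofReal (40 * (min (4 ^ i) w : ℕ) / 2 ^ i / e (i + 1)) := by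
      refine (mul_le_mul_right hnoise _).trans ?_
      rw [← ENNReal.ofReal_mul (by positivity)]
      refine ENNReal.ofReal_le_ofReal ?_
      have hc : ((children T).card : ℝ) ≤ 4 * (min (4 ^ i) w : ℕ) := by
        exact_mod_cast (card_children_le T).trans (Nat.mul_le_mul_left 4 hT)
      have hpos : 0 < 5 / 2 ^ i * (2 / e (i + 1)) := by
        have := he (i + 1)
        positivity
      calc 5 / 2 ^ i * (((children T).card : ℝ) * (2 / e (i + 1)))
          = (5 / 2 ^ i * (2 / e (i + 1))) * ((children T).card : ℝ) := by ring
        _ ≤ (5 / 2 ^ i * (2 / e (i + 1))) * (4 * (min (4 ^ i) w : ℕ)) :=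
            mul_le_mul_of_nonneg_left hc hpos.le
        _ = _ := by ring
    refine (add_le_add_right hnoise' _).trans (le_of_eq ?_)
    have e0 : ∑ j ∈ Finset.range (d + 1), τ (i + j)
        = ∑ j ∈ Finset.range d, τ (i + 1 + j) + τ i := by
      rw [Finset.sum_range_succ', add_zero]
      congr 1
      exact Finset.sum_congr rfl fun j _ => by congr 1; ring
    have e1 : i + (d + 1) = i + 1 + d := by ring
    rw [e1]
    change _ = deficit X i T F + ENNReal.ofReal (∑ j ∈ Finset.range (d + 1), τ (i + j)) + _
    rw [e0, ENNReal.ofReal_add (Finset.sum_nonneg fun _ _ => hτ0 _) (hτ0 _), htail, hτ,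
      ENNReal.ofReal_add (p := 2 * outside (i + 1) X (N (i + 1)) / 2 ^ i)
        (by have := outside_nonneg (i + 1) X (N (i + 1)); positivity)
        (by have := he (i + 1); positivity)]
    ring

/-! ### The privacy budget -/

/-- The share of the privacy budget `ε` that is spent on level `j`: it is largest on level `b` and
decays geometrically in both directions. The rate is close enough to `1` for the decay of the
contribution of the levels to the error to win. -/
noncomputable def budget (ε : ℝ) (b j : ℕ) : ℝ := ε / 8 * (3 / 4) ^ ((j - b) + (b - j))

theorem budget_pos {ε : ℝ} (hε : 0 < ε) (b j : ℕ) : 0 < budget ε b j := by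
  unfold budget
  positivity

theorem sum_pow_gap_le {r : ℝ} (h0 : 0 < r) (h1 : r < 1) (b : ℕ) : ∀ n : ℕ,
    ∑ j ∈ Finset.range n, r ^ ((j - b) + (b - j)) ≤ (2 - r ^ b) / (1 - r) := by
  have hr : 0 < 1 - r := by linarith
  induction b with
  | zero =>
    intro n
    simp only [Nat.sub_zero, Nat.zero_sub, add_zero, pow_zero]
    rw [geom_sum_eq h1.ne, ← neg_div_neg_eq, neg_sub, neg_sub]
    refine div_le_div_of_nonneg_right ?_ hr.le
    linarith [pow_pos h0 n]
  | succ b ih =>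
    intro n
    have hrb : r ^ (b + 1) ≤ 1 := pow_le_one₀ h0.le h1.le
    cases n with
    | zero =>
      rw [Finset.sum_range_zero]
      exact div_nonneg (by linarith) hr.le
    | succ n =>
      rw [Finset.sum_range_succ']
      simp only [Nat.add_sub_add_right, Nat.zero_sub, Nat.sub_zero, zero_add]
      have e : (2 - r ^ (b + 1)) / (1 - r) = (2 - r ^ b) / (1 - r) + r ^ b := by
        field_simp
        ring
      have hmono : r ^ (b + 1) ≤ r ^ b := pow_le_pow_of_le_one h0.le h1.le (Nat.le_succ b)
      rw [e]
      exact add_le_add (ih n) hmono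

theorem sum_budget_le {ε : ℝ} (hε : 0 < ε) (b n : ℕ) :
    ∑ j ∈ Finset.range n, budget ε b j ≤ ε := by
  simp only [budget]
  rw [← Finset.mul_sum]
  have h := sum_pow_gap_le (r := 3 / 4) (by norm_num) (by norm_num) b n
  have h2 : (2 - (3 / 4 : ℝ) ^ b) / (1 - 3 / 4) ≤ 8 := by
    rw [div_le_iff₀ (by norm_num)]
    linarith [pow_pos (by norm_num : (0 : ℝ) < 3 / 4) b]
  nlinarith [h.trans h2]

/-- The number of counted cells, weighted by the cell size, peaks where `4 ^ j` reaches `w`. -/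
theorem min_div_two_pow_le (w j : ℕ) :
    ((min (4 ^ j) w : ℕ) : ℝ) / 2 ^ j
      ≤ 4 * 2 ^ Nat.log 4 w * (1 / 2) ^ ((j - Nat.log 4 w) + (Nat.log 4 w - j)) := by
  set b := Nat.log 4 w with hb
  have h4 : ∀ n : ℕ, (4 : ℝ) ^ n = 2 ^ n * 2 ^ n := fun n => by rw [← mul_pow]; norm_num
  rcases le_total j b with hjb | hjb
  · obtain ⟨c, hc⟩ := Nat.exists_eq_add_of_le hjb
    have h1 : ((min (4 ^ j) w : ℕ) : ℝ) ≤ 4 ^ j := by exact_mod_cast min_le_left _ _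
    rw [hc, Nat.sub_eq_zero_of_le (Nat.le_add_right j c), zero_add, Nat.add_sub_cancel_left,
      div_le_iff₀ (by positivity)]
    refine h1.trans ?_
    rw [h4, pow_add, one_div, inv_pow]
    have e : 4 * ((2 : ℝ) ^ j * 2 ^ c) * (2 ^ c)⁻¹ * 2 ^ j = 4 * (2 ^ j * 2 ^ j) := by field_simp
    rw [e]
    linarith [show (0 : ℝ) < 2 ^ j * 2 ^ j by positivity]
  · obtain ⟨c, hc⟩ := Nat.exists_eq_add_of_le hjb
    have h1 : ((min (4 ^ j) w : ℕ) : ℝ) ≤ 4 ^ (b + 1) := by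
      exact_mod_cast (min_le_right _ _).trans (Nat.lt_pow_succ_log_self (by norm_num) w).le
    rw [hc, Nat.sub_eq_zero_of_le (Nat.le_add_right b c), add_zero, Nat.add_sub_cancel_left,
      div_le_iff₀ (by positivity), ← hc]
    refine h1.trans (le_of_eq ?_)
    rw [hc, pow_succ, h4, pow_add, one_div, inv_pow]
    field_simp

theorem sum_noise_le {ε : ℝ} (hε : 0 < ε) (w d : ℕ) :
    ∑ j ∈ Finset.range d, 40 * ((min (4 ^ j) w : ℕ) : ℝ) / 2 ^ j / budget ε (Nat.log 4 w) (j + 1)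
      ≤ 10240 * 2 ^ Nat.log 4 w / ε := by
  set b := Nat.log 4 w with hb
  -- the cell counts decay by `1/2` per level and the budget by `3/4`, which leaves `2/3`
  have hterm : ∀ j, 40 * ((min (4 ^ j) w : ℕ) : ℝ) / 2 ^ j / budget ε b (j + 1)
      ≤ 40 * 4 * 8 * (4 / 3) * 2 ^ b / ε * (2 / 3) ^ ((j - b) + (b - j)) := by
    intro j
    have h1 := min_div_two_pow_le w j
    rw [← hb] at h1
    have h2 : ε / 8 * (3 / 4) ^ ((j - b) + (b - j) + 1) ≤ budget ε b (j + 1) := by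
      refine mul_le_mul_of_nonneg_left ?_ (by positivity)
      exact pow_le_pow_of_le_one (by norm_num) (by norm_num) (by omega)
    have h3 : 0 < ε / 8 * (3 / 4 : ℝ) ^ ((j - b) + (b - j) + 1) := by positivity
    rw [mul_div_assoc]
    generalize (j - b) + (b - j) = g at *
    calc 40 * (((min (4 ^ j) w : ℕ) : ℝ) / 2 ^ j) / budget ε b (j + 1)
        ≤ 40 * (4 * 2 ^ b * (1 / 2) ^ g) / (ε / 8 * (3 / 4) ^ (g + 1)) := by gcongr
      _ = 40 * 4 * 8 * (4 / 3) * 2 ^ b / ε * ((1 / 2) ^ g / (3 / 4) ^ g) := by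
          rw [pow_succ]
          field_simp
      _ = 40 * 4 * 8 * (4 / 3) * 2 ^ b / ε * (2 / 3) ^ g := by
          rw [← div_pow]
          norm_num
  refine (Finset.sum_le_sum fun j _ => hterm j).trans ?_
  rw [← Finset.mul_sum]
  have h := sum_pow_gap_le (r := 2 / 3) (by norm_num) (by norm_num) b d
  have h2 : (2 - (2 / 3 : ℝ) ^ b) / (1 - 2 / 3) ≤ 6 := by
    rw [div_le_iff₀ (by norm_num)]
    linarith [pow_pos (by norm_num : (0 : ℝ) < 2 / 3) b]
  refine (mul_le_mul_of_nonneg_left (h.trans h2) (by positivity)).trans (le_of_eq ?_)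
  ring

theorem deficit_root_le (hk : 1 ≤ k) (X : Dataset) (n : ℤ) :
    deficit X 0 {(0, 0)} (fun C : CenterSet k => n * pointDist C (corner 0 (0, 0)))
      ≤ ENNReal.ofReal (2 * |(n : ℝ) - X.card|) := by
  refine iSup_le fun C => ENNReal.ofReal_le_ofReal ?_
  have h0 := pointDist_nonneg C (corner 0 (0, 0))
  have h2 := pointDist_origin_le hk C
  have hsum : (X.map fun x => if cell 0 x.1 ∈ ({(0, 0)} : Finset (ℤ × ℤ)) then
      pointDist C x.1 - pointDist C (corner 0 (cell 0 x.1)) else 0).sum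
      = cost C X - X.card * pointDist C (corner 0 (0, 0)) := by
    simp only [cell_zero, Finset.mem_singleton, if_true]
    rw [Multiset.sum_map_sub, Multiset.map_const', Multiset.sum_replicate, nsmul_eq_mul, cost_eq]
  rw [hsum]
  have e : (n : ℝ) * pointDist C (corner 0 (0, 0))
      + (cost C X - X.card * pointDist C (corner 0 (0, 0))) - cost C X
      = (n - X.card) * pointDist C (corner 0 (0, 0)) := by ring
  rw [e, abs_mul, abs_of_nonneg h0, mul_comm 2]
  exact mul_le_mul_of_nonneg_left h2 (abs_nonneg _)

theorem card_div_two_pow_le {ε : ℝ} (hε : 0 < ε) (c : ℕ) (n : ℤ) :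
    2 * (c : ℝ) / 2 ^ ⌈(n : ℝ) * ε⌉₊ ≤ 2 / ε + 2 * |(n : ℝ) - c| := by
  have hpos : (1 : ℝ) ≤ 2 ^ ⌈(n : ℝ) * ε⌉₊ := one_le_pow₀ (by norm_num)
  have h1 : (n : ℝ) * ε ≤ 2 ^ ⌈(n : ℝ) * ε⌉₊ := by
    refine (Nat.le_ceil _).trans ?_
    exact_mod_cast (Nat.lt_two_pow_self (n := ⌈(n : ℝ) * ε⌉₊)).le
  generalize (2 : ℝ) ^ ⌈(n : ℝ) * ε⌉₊ = t at *
  rw [div_le_iff₀ (by linarith)]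
  have h2 : (n : ℝ) ≤ 1 / ε * t := by
    rw [one_div, inv_mul_eq_div, le_div_iff₀ hε]
    exact h1
  have h3 := neg_abs_le ((n : ℝ) - c)
  have h4 : |(n : ℝ) - c| ≤ |(n : ℝ) - c| * t := le_mul_of_one_le_right (abs_nonneg _) hpos
  have e : (2 / ε + 2 * |(n : ℝ) - c|) * t = 2 * (1 / ε * t) + 2 * (|(n : ℝ) - c| * t) := by ring
  rw [e]
  linarith

/-- The expected error of the private estimate is a small fraction of the cost of any set `C₀` of
centers, up to a term of order `√w / ε`. -/
theorem expect_costEstimate_le (hk : 1 ≤ k) {ε : ℝ} (hε : 0 < ε) {m w : ℕ} (hm : 0 < m)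
    (hw : w = (2 * m + 1) ^ 2 * k) (X : Dataset) (C₀ : CenterSet k) :
    expect (costEstimate (k := k) w (budget ε (Nat.log 4 w)) ε X) (estimateError X)
      ≤ ENNReal.ofReal (8 / m * cost C₀ X + 11000 * 2 ^ Nat.log 4 w / ε) := by
  have hw0 : w ≠ 0 := by
    rw [hw]
    positivity
  set b := Nat.log 4 w with hb
  have hcost := cost_nonneg C₀ X
  set A : ℝ := 8 / m * cost C₀ X + 10240 * 2 ^ b / ε + 2 / ε with hA
  have hA0 : 0 ≤ A := by positivity
  have hbranch : ∀ n : ℤ,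
      expect (refine w (budget ε b) X ⌈(n : ℝ) * ε⌉₊ 0 {(0, 0)}
          fun C : CenterSet k => n * pointDist C (corner 0 (0, 0))) (estimateError X)
        ≤ ENNReal.ofReal A + ENNReal.ofReal 4 * ENNReal.ofReal |(n : ℝ) - (X.card : ℤ)| := by
    intro n
    have hN : ∀ j, (near m j C₀).card ≤ w := fun j => hw ▸ card_near_le m j C₀
    have h := expect_refine_le hk (budget_pos hε b) X hN ⌈(n : ℝ) * ε⌉₊ 0 {(0, 0)}
      (fun C : CenterSet k => n * pointDist C (corner 0 (0, 0)))
      (by simpa using Nat.one_le_iff_ne_zero.2 hw0)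
    simp only [zero_add] at h
    rw [Finset.sum_add_distrib] at h
    have h1 := sum_outside_near_le hk hm C₀ X ⌈(n : ℝ) * ε⌉₊
    have h2 := sum_noise_le hε w ⌈(n : ℝ) * ε⌉₊
    have h3 := card_div_two_pow_le hε X.card n
    rw [← hb] at h2
    refine h.trans ?_
    refine (add_le_add (add_le_add (deficit_root_le hk X n)
      (ENNReal.ofReal_le_ofReal (add_le_add h1 h2))) (ENNReal.ofReal_le_ofReal h3)).trans ?_
    rw [← ENNReal.ofReal_add (by positivity) (by positivity),
      ← ENNReal.ofReal_add (by positivity) (by positivity),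
      ← ENNReal.ofReal_mul (by norm_num), ← ENNReal.ofReal_add hA0 (by positivity)]
    refine ENNReal.ofReal_le_ofReal (le_of_eq ?_)
    rw [hA, Int.cast_natCast]
    ring
  rw [costEstimate, expect_bind]
  refine (expect_mono _ hbranch).trans ?_
  rw [expect_add, expect_const, expect_const_mul]
  refine (add_le_add_right (mul_le_mul_right
    (expect_laplaceAt_le (budget_pos hε b 0) (X.card : ℤ)) _) _).trans ?_
  have hb0 := budget_pos hε b 0
  rw [← ENNReal.ofReal_mul (by norm_num), ← ENNReal.ofReal_add hA0 (by positivity)]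
  refine ENNReal.ofReal_le_ofReal ?_
  have hroot : 4 * (2 / budget ε b 0) ≤ 64 * 2 ^ b / ε := by
    have e : 4 * (2 / budget ε b 0) = 64 / ε * (4 / 3) ^ b := by
      rw [budget, Nat.zero_sub, Nat.sub_zero, zero_add,
        show (4 / 3 : ℝ) = (3 / 4)⁻¹ by norm_num, inv_pow]
      field_simp
      norm_num
    rw [e, mul_div_right_comm]
    gcongr
    norm_num
  have h2b : (2 : ℝ) / ε ≤ 2 * 2 ^ b / ε := by
    gcongr
    linarith [one_le_pow₀ (n := b) (by norm_num : (1 : ℝ) ≤ 2)]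
  have e : 11000 * 2 ^ b / ε = 10240 * 2 ^ b / ε + 2 * 2 ^ b / ε + 64 * 2 ^ b / ε
      + 694 * (2 ^ b / ε) := by ring
  have hp : 0 ≤ 694 * ((2 : ℝ) ^ b / ε) := by positivity
  rw [hA, e]
  linarith

/-! ### The mechanism -/

instance centerSet_nonempty (k : ℕ) : Nonempty (CenterSet k) := by
  have hinj : Function.Injective fun n : ℕ => (⟨(1 / ((n : ℝ) + 2), 0), by
      have h : (0 : ℝ) < (n : ℝ) + 2 := by positivity
      refine ⟨⟨by positivity, ?_⟩, by norm_num⟩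
      rw [div_lt_one h]
      linarith [(Nat.cast_nonneg n : (0 : ℝ) ≤ n)]⟩ : Square) := by
    intro a b hab
    have h := congrArg (fun p : Square => p.1.1) hab
    simpa using h
  have : Infinite Square := Infinite.of_injective _ hinj
  obtain ⟨s, hs⟩ := Infinite.exists_subset_card_eq Square k
  exact ⟨⟨s, hs⟩⟩

theorem exists_near_minimizer {F : CenterSet k → ℝ} {B : ℝ} (hB : ∀ C, B ≤ F C) {s : ℝ}
    (hs : 0 < s) : ∃ C, ∀ C', F C ≤ F C' + s := by
  have hbdd : BddBelow (Set.range F) := ⟨B, by rintro _ ⟨C, rfl⟩; exact hB C⟩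
  obtain ⟨C, hC⟩ := exists_lt_of_ciInf_lt (show ⨅ C, F C < (⨅ C, F C) + s by linarith)
  exact ⟨C, fun C' => by linarith [ciInf_le hbdd C']⟩

open Classical in
/-- A set of centers whose value under `F` is within `s` of the smallest, if there is one. -/
noncomputable def nearMinimizer (s : ℝ) (F : CenterSet k → ℝ) : CenterSet k :=
  if h : ∃ C, ∀ C', F C ≤ F C' + s then h.choose else Classical.arbitrary _

theorem nearMinimizer_spec {s : ℝ} {F : CenterSet k → ℝ} (h : ∃ C, ∀ C', F C ≤ F C' + s)
    (C' : CenterSet k) : F (nearMinimizer s F) ≤ F C' + s := by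
  rw [nearMinimizer, dif_pos h]
  exact h.choose_spec C'

/-- The distance from a center, in cell sides, up to which a cell is near. The far points add at most
`8 / radius lam` times the cost to the expected error; Markov's inequality multiplies this by `100`
and the comparison of two sets of centers by `2`, which gives the fraction `lam`. -/
noncomputable def radius (lam : ℝ) : ℕ := ⌈1600 / lam⌉₊

/-- The number of cells that are kept on each level: enough for all cells near `k` centers. -/
noncomputable def width (lam : ℝ) (k : ℕ) : ℕ := (2 * radius lam + 1) ^ 2 * k

/-- The private `k`-median mechanism: a near-minimizer of the private cost estimate. -/
noncomputable def mechanism (lam ε : ℝ) (k : ℕ) (X : Dataset) : PMF (CenterSet k) :=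
  (costEstimate (width lam k) (budget ε (Nat.log 4 (width lam k))) ε X).map
    (nearMinimizer (1 / ε))

theorem mechanism_isDP (lam : ℝ) {ε : ℝ} (hε : 0 < ε) (k : ℕ) : IsDP ε (mechanism lam ε k) :=
  fun _ _ h O => LogRatioLE.prob_le ((costEstimate_logRatioLE (budget_pos hε _)
    (sum_budget_le hε _) _ h).map _) O

theorem abs_sub_cost_le_of_estimateError_le {X : Dataset} {F : CenterSet k → ℝ} {R : ℝ}
    (hR : 0 ≤ R) (h : estimateError X F ≤ ENNReal.ofReal R) (C : CenterSet k) :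
    |F C - cost C X| ≤ R :=
  (ENNReal.ofReal_le_ofReal_iff hR).1
    ((le_iSup (fun C => ENNReal.ofReal |F C - cost C X|) C).trans h)

theorem cost_nearMinimizer_le {X : Dataset} {F : CenterSet k → ℝ} {R s : ℝ} (hR : 0 ≤ R)
    (hs : 0 < s) (h : estimateError X F ≤ ENNReal.ofReal R) (C : CenterSet k) :
    cost (nearMinimizer s F) X ≤ cost C X + 2 * R + s := by
  have habs := abs_sub_cost_le_of_estimateError_le hR h
  have hmin := nearMinimizer_spec (exists_near_minimizer (F := F) (B := -R)
    (fun C => by linarith [neg_le_of_abs_le (habs C), cost_nonneg C X]) hs) C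
  linarith [neg_le_of_abs_le (habs (nearMinimizer s F)), le_of_abs_le (habs C)]

theorem two_pow_log_width_le (lam : ℝ) {k : ℕ} (hk : 1 ≤ k) :
    (2 : ℝ) ^ Nat.log 4 (width lam k) ≤ (2 * radius lam + 1) * Real.sqrt k := by
  have hw0 : width lam k ≠ 0 := by
    unfold width
    positivity
  have h : (4 : ℝ) ^ Nat.log 4 (width lam k) ≤ width lam k := by
    exact_mod_cast Nat.pow_log_le_self 4 hw0
  refine (pow_le_pow_iff_left₀ (by positivity) (by positivity) two_ne_zero).1 ?_
  rw [mul_pow, Real.sq_sqrt (Nat.cast_nonneg k), ← pow_mul, mul_comm _ 2, pow_mul]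
  refine le_trans (le_of_eq (by norm_num)) (h.trans (le_of_eq ?_))
  simp [width]

theorem le_prob_isApprox {lam : ℝ} (hlam : 0 < lam) (hlam1 : lam < 1) {ε : ℝ} (hε : 0 < ε) {k : ℕ}
    (hk : 1 ≤ k) (X : Dataset) :
    ENNReal.ofReal (99 / 100) ≤ prob (mechanism lam ε k X)
      {C | IsApprox (1 + lam)
        ((2200000 * (2 * radius lam + 1) + 3) * (Real.sqrt k / ε)) X C} := by
  have hm : 1600 / lam ≤ (radius lam : ℝ) := Nat.le_ceil _
  have hm0 : (0 : ℝ) < radius lam := lt_of_lt_of_le (by positivity) hm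
  have hk1 : (1 : ℝ) ≤ Real.sqrt k := Real.one_le_sqrt.2 (by exact_mod_cast hk)
  -- the optimum need not be attained, so the output is compared to a near-optimal set of centers
  obtain ⟨C₀, hC₀⟩ := exists_near_minimizer (F := fun C : CenterSet k => cost C X) (B := 0)
    (fun C => cost_nonneg C X) (s := 1 / ε) (by positivity)
  have hcost := cost_nonneg C₀ X
  set R : ℝ := 8 / radius lam * cost C₀ X + 11000 * ((2 * radius lam + 1) * Real.sqrt k) / ε
    with hR
  have hR0 : 0 < R := by positivity
  have hE : expect (costEstimate (k := k) (width lam k) (budget ε (Nat.log 4 (width lam k))) ε X)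
      (estimateError X) ≤ ENNReal.ofReal R := by
    refine (expect_costEstimate_le hk hε (by exact_mod_cast hm0) rfl X C₀).trans
      (ENNReal.ofReal_le_ofReal ?_)
    rw [hR]
    gcongr
    exact two_pow_log_width_le lam hk
  refine (le_prob_of_expect_le _ hR0 hE).trans ?_
  rw [prob, prob, mechanism, PMF.toOuterMeasure_map_apply]
  refine (PMF.toOuterMeasure _).mono fun F hF C' => ?_
  have hout := cost_nearMinimizer_le (s := 1 / ε) (by positivity) (by positivity) hF C₀
  have hopt := hC₀ C'
  have hfrac : 1600 / (radius lam : ℝ) * cost C₀ X ≤ lam * cost C₀ X := by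
    refine mul_le_mul_of_nonneg_right ?_ hcost
    rw [div_le_iff₀ hm0]
    rwa [div_le_iff₀ hlam, mul_comm] at hm
  have hslack : 1 / ε ≤ Real.sqrt k / ε := by gcongr
  have h1 : (1 + lam) * cost C₀ X ≤ (1 + lam) * (cost C' X + 1 / ε) :=
    mul_le_mul_of_nonneg_left hopt (by linarith)
  have h2 : (1 + lam) * (1 / ε) ≤ 2 * (1 / ε) :=
    mul_le_mul_of_nonneg_right (by linarith) (by positivity)
  have e : 2 * (100 * R) = 1600 / (radius lam : ℝ) * cost C₀ X
      + 2200000 * (2 * radius lam + 1) * (Real.sqrt k / ε) := by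
    rw [hR]
    ring
  rw [e] at hout
  linarith

end PrivateKMedian

/-- The algorithm `M` receives the parameters `lam`, `ε`, `k` and the dataset `X`; the number of
users is not given to it. The constant `c` depends on `lam` only. -/
theorem mainTheorem4 :
    ∃ M : ℝ → ℝ → (k : ℕ) → PrivateKMedian.Dataset → PMF (PrivateKMedian.CenterSet k),
      ∀ lam : ℝ, 0 < lam → lam < 1 →
        ∃ c : ℝ, 0 < c ∧
          ∀ ε : ℝ, 0 < ε → ∀ k : ℕ, 1 ≤ k →
            PrivateKMedian.IsDP ε (M lam ε k) ∧
            ∀ X : PrivateKMedian.Dataset,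
              ENNReal.ofReal (99 / 100) ≤
                PrivateKMedian.prob (M lam ε k X)
                  {C | PrivateKMedian.IsApprox (1 + lam) (c * (Real.sqrt k / ε)) X C} :=
  ⟨PrivateKMedian.mechanism, fun lam hlam hlam1 =>
    ⟨2200000 * (2 * PrivateKMedian.radius lam + 1) + 3, by positivity, fun _ hε _ hk =>
      ⟨PrivateKMedian.mechanism_isDP lam hε _,
        PrivateKMedian.le_prob_isApprox hlam hlam1 hε hk⟩⟩⟩
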